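/- Let $$\Omega_x = \begin{pmatrix} 0 & -1 & 0\\ 1 & 0 & 0\\ 0 & 0 & 0\end{pmatrix},\qquad \Omega_z = \begin{pmatrix} 0 & 0 & 0\\ 0 & 0 & -1\\ 0 & 1 & 0\end{pmatrix},$$ and let $\Theta_x = \{\exp(t\,\Omega_x) : t\in\mathbb{R}\}\subset SO(3)$ be the one-parameter subgroup generated by $\Omega_x$. Consider on $SO(3)$ the control system $$\dot\Theta = (\Omega_z + v\,\Omega_x)\,\Theta,\qquad \Theta(0)=I,$$ where the control $v:[0,\infty)\to\mathbb{R}$ is measurable and locally bounded. For $T\ge 0$ let $\mathbf R(I,T)\subset SO(3)$ be the set of all values $\Theta(t)$, $0\le t\le T$, of solutions of this system for such controls, and define the infimizing time of $\Theta_F\in SO(3)$ by $$t^*(\Theta_F) = \inf\{T\ge 0 : \Theta_F\in\overline{\mathbf R(I,T)}\}.$$ Then for every $\Theta_F\in SO(3)$ there is a unique $\beta\in[0,\pi]$ such that $\Theta_F = Q_1\exp(\beta\,\Omega_z)\,Q_2$ for some $Q_1,Q_2\in\Theta_x$, the set in the definition of $t^*(\Theta_F)$ is nonempty, and $t^*(\Theta_F)=\beta$.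 -/

import Mathlib

namespace TimeOptimal

/-- The rotation group `SO(3)`. -/
abbrev SO3 : Type := Matrix.specialOrthogonalGroup (Fin 3) ℝ

/-- The generator `Ω_x`. -/
def OmegaX : Matrix (Fin 3) (Fin 3) ℝ :=
  !![0, -1, 0;
     1, 0, 0;
     0, 0, 0]

/-- The generator `Ω_z`. -/
def OmegaZ : Matrix (Fin 3) (Fin 3) ℝ :=
  !![0, 0, 0;
     0, 0, -1;
     0, 1, 0]

/-- The one-parameter subgroup `{exp (tX) : t ∈ ℝ}`, as a subset of `SO(3)`. -/
def oneParameterSubgroup (X : Matrix (Fin 3) (Fin 3) ℝ) : Set SO3 :=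
  {Q | ∃ t : ℝ, (Q : Matrix (Fin 3) (Fin 3) ℝ) = NormedSpace.exp (t • X)}

/-- Admissible controls: measurable and locally bounded on `[0, ∞)`
(the values at negative times play no role). -/
def IsControl (v : ℝ → ℝ) : Prop :=
  Measurable v ∧ ∀ T : ℝ, ∃ M : ℝ, ∀ t ∈ Set.Icc 0 T, |v t| ≤ M

/-- `Θ` is the (Carathéodory) solution on `[0, ∞)`, with values in `SO(3)`, of
`dΘ/dt = (Xd + v X₁) Θ`, `Θ(0) = Θ₀`: it is continuous and satisfies the integrated equation
entry by entry. The integrands are integrable on `[0, t]` when `v` is an admissible control. -/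
def IsTrajectory (Xd X₁ : Matrix (Fin 3) (Fin 3) ℝ) (v : ℝ → ℝ) (Θ₀ : SO3) (Θ : ℝ → SO3) :
    Prop :=
  ContinuousOn Θ (Set.Ici 0) ∧
    ∀ t : ℝ, 0 ≤ t → ∀ i j : Fin 3,
      (Θ t : Matrix (Fin 3) (Fin 3) ℝ) i j =
        (Θ₀ : Matrix (Fin 3) (Fin 3) ℝ) i j +
          ∫ s in (0 : ℝ)..t, ((Xd + v s • X₁) * (Θ s : Matrix (Fin 3) (Fin 3) ℝ)) i j

/-- The set `R(Θ₀, t)` of points attainable from `Θ₀` at time `t`. -/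
def reachableAt (Xd X₁ : Matrix (Fin 3) (Fin 3) ℝ) (Θ₀ : SO3) (t : ℝ) : Set SO3 :=
  {Θ' | ∃ (v : ℝ → ℝ) (Θ : ℝ → SO3),
    IsControl v ∧ IsTrajectory Xd X₁ v Θ₀ Θ ∧ Θ t = Θ'}

/-- The union of the sets `R(Θ₀, t)` over `0 ≤ t ≤ T`. -/
def reachableWithin (Xd X₁ : Matrix (Fin 3) (Fin 3) ℝ) (Θ₀ : SO3) (T : ℝ) : Set SO3 :=
  ⋃ t ∈ Set.Icc 0 T, reachableAt Xd X₁ Θ₀ t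

/-- The times `T ≥ 0` such that `ΘF` lies in the closure of the set of points attainable from
the identity within time `T`. -/
def approachTimes (Xd X₁ : Matrix (Fin 3) (Fin 3) ℝ) (ΘF : SO3) : Set ℝ :=
  {T | 0 ≤ T ∧ ΘF ∈ closure (reachableWithin Xd X₁ 1 T)}

/-- The infimizing time `t*(ΘF)`. -/
noncomputable def infimizingTime (Xd X₁ : Matrix (Fin 3) (Fin 3) ℝ) (ΘF : SO3) : ℝ :=
  sInf (approachTimes Xd X₁ ΘF)

/-- `ΘF = Q₁ exp(β Ω_z) Q₂` for some `Q₁, Q₂` in the one-parameter subgroup generated by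
`Ω_x`. -/
def HasDecomposition (ΘF : SO3) (β : ℝ) : Prop :=
  ∃ Q₁ ∈ oneParameterSubgroup OmegaX, ∃ Q₂ ∈ oneParameterSubgroup OmegaX,
    (ΘF : Matrix (Fin 3) (Fin 3) ℝ) =
      (Q₁ : Matrix (Fin 3) (Fin 3) ℝ) * NormedSpace.exp (β • OmegaZ) *
        (Q₂ : Matrix (Fin 3) (Fin 3) ℝ)

end TimeOptimal

/-! Everything is read off the last diagonal entry `z` of the rotation. Both factors in `Θ_x` fix
the third basis vector, so a rotation with middle angle `β` has `z = cos β`; this gives uniqueness,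
and Euler angles give existence.

Lower bound: the last row of `Ω_x` is zero, so along a trajectory `z' = y` with `y` the entry above
`z`, whatever the control. Columns are unit vectors, so `y² + z² ≤ 1` and `z` falls from `1` no
faster than cosine (`cos_le_of_hasDerivWithinAt`). The bound `cos T ≤ z` is a closed condition, so
it survives the closure.

Upper bound: a huge constant control over a short time approximates any element of `Θ_x`
(`tendsto_flow_div`). Impulse, free drift for time `β`, impulse: the target is approached within any
time above `β`. -/

namespace TimeOptimal

open Matrix MeasureTheory

/-! ### Matrix exponentials of the generators -/

section Exponential

attribute [local instance] Matrix.linftyOpNormedRing Matrix.linftyOpNormedAlgebra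

theorem continuous_matrix_exp :
    Continuous (NormedSpace.exp : Matrix (Fin 3) (Fin 3) ℝ → Matrix (Fin 3) (Fin 3) ℝ) :=
  NormedSpace.exp_continuous

theorem hasDerivAt_apply {F : ℝ → Matrix (Fin 3) (Fin 3) ℝ} {F' : Matrix (Fin 3) (Fin 3) ℝ} {t : ℝ}
    (h : HasDerivAt F F' t) (i j : Fin 3) : HasDerivAt (fun t => F t i j) (F' i j) t :=
  (LinearMap.toContinuousLinearMap
    (Matrix.entryLinearMap ℝ ℝ i j)).hasFDerivAt.comp_hasDerivAt t h

theorem hasDerivAt_exp_mul_apply (X g : Matrix (Fin 3) (Fin 3) ℝ) (t : ℝ) (i j : Fin 3) :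
    HasDerivAt (fun t : ℝ => (NormedSpace.exp (t • X) * g) i j)
      ((X * (NormedSpace.exp (t • X) * g)) i j) t := by
  have := hasDerivAt_apply ((hasDerivAt_exp_smul_const' (𝕂 := ℝ) X t).mul_const g) i j
  rwa [mul_assoc] at this

theorem hasDerivAt_exp_neg_apply (X : Matrix (Fin 3) (Fin 3) ℝ) (t : ℝ) (i j : Fin 3) :
    HasDerivAt (fun t : ℝ => NormedSpace.exp (t • -X) i j)
      ((NormedSpace.exp (t • -X) * -X) i j) t :=
  hasDerivAt_apply (hasDerivAt_exp_smul_const (𝕂 := ℝ) (-X) t) i j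

theorem exp_add_smul (X : Matrix (Fin 3) (Fin 3) ℝ) (s t : ℝ) :
    NormedSpace.exp ((s + t) • X) = NormedSpace.exp (s • X) * NormedSpace.exp (t • X) := by
  rw [add_smul, Matrix.exp_add_of_commute]
  exact ((Commute.refl X).smul_left s).smul_right t

end Exponential

/-- A matrix curve solving `R' = X R`, `R 0 = 1` entry by entry is `t ↦ exp (t X)`. -/
theorem exp_smul_eq_of_hasDerivAt {X : Matrix (Fin 3) (Fin 3) ℝ}
    {R : ℝ → Matrix (Fin 3) (Fin 3) ℝ} (h0 : R 0 = 1)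
    (h : ∀ t i j, HasDerivAt (fun t => R t i j) ((X * R t) i j) t) (t : ℝ) :
    NormedSpace.exp (t • X) = R t := by
  -- The product `exp (-sX) R(s)` has zero derivative, hence stays equal to `1`.
  have hd : ∀ i j s, HasDerivAt (fun s => (NormedSpace.exp (s • -X) * R s) i j) 0 s := by
    intro i j s
    have key : HasDerivAt (fun s => ∑ k, NormedSpace.exp (s • -X) i k * R s k j)
        (∑ k, ((NormedSpace.exp (s • -X) * -X) i k * R s k j +
          NormedSpace.exp (s • -X) i k * (X * R s) k j)) s :=
      HasDerivAt.fun_sum fun k _ => (hasDerivAt_exp_neg_apply X s i k).mul (h s k j)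
    rw [Finset.sum_add_distrib, ← Matrix.mul_apply, ← Matrix.mul_apply, ← Matrix.mul_assoc,
      Matrix.mul_neg, Matrix.neg_mul, Matrix.neg_apply, neg_add_cancel] at key
    exact key
  have hone : NormedSpace.exp (t • -X) * R t = 1 := by
    ext i j
    have := is_const_of_deriv_eq_zero (fun s => (hd i j s).differentiableAt)
      (fun s => (hd i j s).deriv) t 0
    simpa [h0] using this
  have hinv : NormedSpace.exp (t • X) * NormedSpace.exp (t • -X) = 1 := by
    have := exp_add_smul X t (-t)
    simpa using this.symm
  calc NormedSpace.exp (t • X) = NormedSpace.exp (t • X) * (NormedSpace.exp (t • -X) * R t) := by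
        rw [hone, mul_one]
    _ = R t := by rw [← mul_assoc, hinv, one_mul]

theorem exp_smul_OmegaX (t : ℝ) : NormedSpace.exp (t • OmegaX) =
    !![Real.cos t, -Real.sin t, 0; Real.sin t, Real.cos t, 0; 0, 0, 1] := by
  refine exp_smul_eq_of_hasDerivAt
    (R := fun t => !![Real.cos t, -Real.sin t, 0; Real.sin t, Real.cos t, 0; 0, 0, 1]) ?_ ?_ t
  · ext i j; fin_cases i <;> fin_cases j <;> simp
  · intro t i j
    have hs := Real.hasDerivAt_sin t
    have hc := Real.hasDerivAt_cos t
    have hn := hs.neg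
    have h0 := hasDerivAt_const t (0 : ℝ)
    have h1 := hasDerivAt_const t (1 : ℝ)
    fin_cases i <;> fin_cases j <;>
      simpa [OmegaX, Matrix.mul_apply, Fin.sum_univ_three, Pi.neg_def]

theorem exp_smul_OmegaZ (t : ℝ) : NormedSpace.exp (t • OmegaZ) =
    !![1, 0, 0; 0, Real.cos t, -Real.sin t; 0, Real.sin t, Real.cos t] := by
  refine exp_smul_eq_of_hasDerivAt
    (R := fun t => !![1, 0, 0; 0, Real.cos t, -Real.sin t; 0, Real.sin t, Real.cos t]) ?_ ?_ t
  · ext i j; fin_cases i <;> fin_cases j <;> simp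
  · intro t i j
    have hs := Real.hasDerivAt_sin t
    have hc := Real.hasDerivAt_cos t
    have hn := hs.neg
    have h0 := hasDerivAt_const t (0 : ℝ)
    have h1 := hasDerivAt_const t (1 : ℝ)
    fin_cases i <;> fin_cases j <;>
      simpa [OmegaZ, Matrix.mul_apply, Fin.sum_univ_three, Pi.neg_def]

/-- The exponential of a skew-symmetric matrix is a rotation. -/
theorem exp_mem_SO3 {X : Matrix (Fin 3) (Fin 3) ℝ} (hX : Xᵀ = -X) :
    NormedSpace.exp X ∈ Matrix.specialOrthogonalGroup (Fin 3) ℝ := by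
  have horth : ∀ Y : Matrix (Fin 3) (Fin 3) ℝ, Yᵀ = -Y →
      NormedSpace.exp Y * (NormedSpace.exp Y)ᵀ = 1 := by
    intro Y hY
    rw [← Matrix.exp_transpose, hY]
    have := exp_add_smul Y 1 (-1)
    simpa using this.symm
  rw [Matrix.mem_specialOrthogonalGroup_iff, Matrix.mem_orthogonalGroup_iff]
  refine ⟨horth X hX, ?_⟩
  -- Orthogonality only gives `det = ±1`; writing `exp X` as the square of `exp (X/2)` settles the
  -- sign.
  have hhalf : ((1 / 2 : ℝ) • X)ᵀ = -((1 / 2 : ℝ) • X) := by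
    rw [Matrix.transpose_smul, hX, smul_neg]
  have h := congrArg Matrix.det (horth _ hhalf)
  rw [Matrix.det_mul, Matrix.det_transpose, Matrix.det_one] at h
  have hsplit := exp_add_smul X (1 / 2) (1 / 2)
  norm_num at hsplit
  rw [hsplit, Matrix.det_mul]
  simpa using h

theorem transpose_smul_OmegaX (t : ℝ) : (t • OmegaX)ᵀ = -(t • OmegaX) := by
  ext i j; fin_cases i <;> fin_cases j <;> simp [OmegaX]

theorem transpose_smul_OmegaZ (t : ℝ) : (t • OmegaZ)ᵀ = -(t • OmegaZ) := by
  ext i j; fin_cases i <;> fin_cases j <;> simp [OmegaZ]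

/-! ### Euler angles -/

theorem HasDecomposition.apply_two_two {Θ : SO3} {β : ℝ} (h : HasDecomposition Θ β) :
    (Θ : Matrix (Fin 3) (Fin 3) ℝ) 2 2 = Real.cos β := by
  obtain ⟨Q₁, ⟨s, hs⟩, Q₂, ⟨t, ht⟩, hΘ⟩ := h
  rw [hΘ, hs, ht, exp_smul_OmegaX, exp_smul_OmegaX, exp_smul_OmegaZ]
  simp [Matrix.mul_apply, Fin.sum_univ_three]

theorem SO3.row_sq (Θ : SO3) (i : Fin 3) :
    Θ.1 i 0 ^ 2 + Θ.1 i 1 ^ 2 + Θ.1 i 2 ^ 2 = 1 := by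
  have h := (Matrix.mem_orthogonalGroup_iff (Fin 3) ℝ).1
    (Matrix.mem_specialOrthogonalGroup_iff.1 Θ.2).1
  have := congrFun (congrFun h i) i
  simp [Matrix.mul_apply, Fin.sum_univ_three] at this
  linarith

theorem SO3.col_sq (Θ : SO3) (j : Fin 3) :
    Θ.1 0 j ^ 2 + Θ.1 1 j ^ 2 + Θ.1 2 j ^ 2 = 1 := by
  have h := (Matrix.mem_orthogonalGroup_iff' (Fin 3) ℝ).1
    (Matrix.mem_specialOrthogonalGroup_iff.1 Θ.2).1
  have := congrFun (congrFun h j) j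
  simp [Matrix.mul_apply, Fin.sum_univ_three] at this
  linarith

theorem exists_angle {a b r : ℝ} (h : a ^ 2 + b ^ 2 = r ^ 2) :
    ∃ φ : ℝ, a = r * Real.cos φ ∧ b = r * Real.sin φ := by
  rcases eq_or_ne r 0 with rfl | hr
  · exact ⟨0, by nlinarith [sq_nonneg a, sq_nonneg b], by nlinarith [sq_nonneg a, sq_nonneg b]⟩
  · have hz : ‖(⟨a / r, b / r⟩ : ℂ)‖ = 1 := by
      rw [← sq_eq_sq₀ (norm_nonneg _) zero_le_one, Complex.sq_norm, Complex.normSq_mk]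
      field_simp
      linarith
    refine ⟨Complex.arg ⟨a / r, b / r⟩, ?_, ?_⟩
    · rw [Complex.cos_arg (by rw [← norm_ne_zero_iff, hz]; exact one_ne_zero), hz]
      field_simp
    · rw [Complex.sin_arg, hz]
      field_simp

/-- A rotation fixing the third basis vector belongs to the subgroup generated by `Ω_x`. -/
theorem mem_oneParameterSubgroup_OmegaX {Θ : SO3} (h : Θ.1 2 2 = 1) :
    Θ ∈ oneParameterSubgroup OmegaX := by
  have hr := SO3.row_sq Θ 2
  have hc := SO3.col_sq Θ 2
  rw [h] at hr hc
  have h20 : Θ.1 2 0 = 0 := by nlinarith [sq_nonneg (Θ.1 2 0), sq_nonneg (Θ.1 2 1)]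
  have h21 : Θ.1 2 1 = 0 := by nlinarith [sq_nonneg (Θ.1 2 0), sq_nonneg (Θ.1 2 1)]
  have h02 : Θ.1 0 2 = 0 := by nlinarith [sq_nonneg (Θ.1 0 2), sq_nonneg (Θ.1 1 2)]
  have h12 : Θ.1 1 2 = 0 := by nlinarith [sq_nonneg (Θ.1 0 2), sq_nonneg (Θ.1 1 2)]
  have c0 := SO3.col_sq Θ 0
  have c1 := SO3.col_sq Θ 1
  have hdet := (Matrix.mem_specialOrthogonalGroup_iff.1 Θ.2).2
  rw [Matrix.det_fin_three, h, h20, h21, h02, h12] at hdet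
  rw [h20] at c0
  rw [h21] at c1
  obtain ⟨φ, h00, h10⟩ := exists_angle (a := Θ.1 0 0) (b := Θ.1 1 0) (r := 1) (by linarith)
  -- The two squares supplied sum to `2 - 2 det = 0`.
  have h11 : Θ.1 1 1 = Θ.1 0 0 := by
    nlinarith [sq_nonneg (Θ.1 1 1 - Θ.1 0 0), sq_nonneg (Θ.1 0 1 + Θ.1 1 0)]
  have h01 : Θ.1 0 1 = -Θ.1 1 0 := by
    nlinarith [sq_nonneg (Θ.1 1 1 - Θ.1 0 0), sq_nonneg (Θ.1 0 1 + Θ.1 1 0)]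
  refine ⟨φ, ?_⟩
  rw [exp_smul_OmegaX]
  rw [one_mul] at h00 h10
  rw [h00] at h11
  rw [h10] at h01
  ext i j
  fin_cases i <;> fin_cases j <;> simp [h, h20, h21, h02, h12, h00, h10, h11, h01]

/-- With `β = arccos z`, choose `φ` so that `exp (φ Ω_x) exp (β Ω_z)` sends the third basis vector
to the third column of `Θ`; what remains fixes that vector, so lies in `Θ_x`. -/
theorem exists_hasDecomposition (Θ : SO3) :
    ∃ β ∈ Set.Icc 0 Real.pi, HasDecomposition Θ β := by
  have hc := SO3.col_sq Θ 2
  have hlo : -1 ≤ Θ.1 2 2 := by nlinarith [sq_nonneg (Θ.1 0 2), sq_nonneg (Θ.1 1 2)]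
  have hhi : Θ.1 2 2 ≤ 1 := by nlinarith [sq_nonneg (Θ.1 0 2), sq_nonneg (Θ.1 1 2)]
  set β := Real.arccos (Θ.1 2 2) with hβ
  have hcos : Real.cos β = Θ.1 2 2 := Real.cos_arccos hlo hhi
  have hsc := Real.sin_sq_add_cos_sq β
  obtain ⟨φ, h12, h02⟩ := exists_angle (a := -Θ.1 1 2) (b := Θ.1 0 2) (r := Real.sin β)
    (by rw [← hcos] at hc; linarith)
  let Q₁ : SO3 := ⟨_, exp_mem_SO3 (transpose_smul_OmegaX φ)⟩
  let Z : SO3 := ⟨_, exp_mem_SO3 (transpose_smul_OmegaZ β)⟩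
  refine ⟨β, ⟨Real.arccos_nonneg _, Real.arccos_le_pi _⟩, Q₁, ⟨φ, rfl⟩, Z⁻¹ * Q₁⁻¹ * Θ,
    mem_oneParameterSubgroup_OmegaX ?_, ?_⟩
  · have hval : (Z⁻¹ * Q₁⁻¹ * Θ : SO3).1 =
        (NormedSpace.exp (β • OmegaZ))ᵀ * (NormedSpace.exp (φ • OmegaX))ᵀ * Θ.1 := rfl
    rw [hval, exp_smul_OmegaX, exp_smul_OmegaZ]
    simp [Matrix.mul_apply, Fin.sum_univ_three]
    have h12' : Θ.1 1 2 = -(Real.sin β * Real.cos φ) := by linarith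
    rw [h12', h02, ← hcos]
    linear_combination hsc + (Real.sin β) ^ 2 * Real.sin_sq_add_cos_sq φ
  · have : Θ = Q₁ * Z * (Z⁻¹ * Q₁⁻¹ * Θ) := by group
    exact congrArg Subtype.val this

theorem existsUnique_hasDecomposition (Θ : SO3) :
    ∃! β : ℝ, β ∈ Set.Icc 0 Real.pi ∧ HasDecomposition Θ β := by
  obtain ⟨β, hβ, h⟩ := exists_hasDecomposition Θ
  refine ⟨β, ⟨hβ, h⟩, fun γ ⟨hγ, h'⟩ => Real.injOn_cos hγ hβ ?_⟩
  rw [← h.apply_two_two, ← h'.apply_two_two]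

/-! ### Lower bound on the time -/

theorem cos_le_of_hasDerivWithinAt {z y : ℝ → ℝ} (hz : ContinuousOn z (Set.Ici 0))
    (h0 : z 0 = 1) (hd : ∀ t, 0 ≤ t → HasDerivWithinAt z (y t) (Set.Ici t) t)
    (hy : ∀ t, 0 ≤ t → y t ^ 2 + z t ^ 2 ≤ 1) {T : ℝ} (hT0 : 0 ≤ T) (hT : T < Real.pi) :
    Real.cos T ≤ z T := by
  -- The comparison theorem needs a strict slope inequality at contact, where cosine itself gives
  -- only equality. The factor `1 + ε` makes the barrier steeper, and the shift `ε` keeps its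
  -- argument off `0`, where sine vanishes.
  have key : ∀ᶠ ε : ℝ in nhdsWithin 0 (Set.Ioi 0), Real.cos (ε + (1 + ε) * T) ≤ z T := by
    have hsmall : ∀ᶠ ε : ℝ in nhdsWithin 0 (Set.Ioi 0), ε + (1 + ε) * T < Real.pi := by
      have hc : Filter.Tendsto (fun ε : ℝ => ε + (1 + ε) * T) (nhds 0) (nhds (0 + (1 + 0) * T)) :=
        (by fun_prop : Continuous fun ε : ℝ => ε + (1 + ε) * T).tendsto 0
      have := hc.eventually_lt_const (u := Real.pi) (by simpa using hT)
      exact this.filter_mono nhdsWithin_le_nhds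
    filter_upwards [hsmall, self_mem_nhdsWithin] with ε hε hpos
    have hpos : 0 < ε := hpos
    have := image_le_of_deriv_right_lt_deriv_boundary (f := fun t => -z t) (f' := fun t => -y t)
      (a := 0) (b := T) (B := fun t => -Real.cos (ε + (1 + ε) * t))
      (B' := fun t => Real.sin (ε + (1 + ε) * t) * (1 + ε))
      (hz.neg.mono Set.Icc_subset_Ici_self) (fun t ht => (hd t ht.1).neg)
      (by simpa [h0] using Real.cos_le_one ε)
      (fun t => by
        have h1 : HasDerivAt (fun t : ℝ => ε + (1 + ε) * t) (1 + ε) t := by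
          simpa using ((hasDerivAt_id t).const_mul (1 + ε)).const_add ε
        simpa using h1.cos.fun_neg)
      (fun t ht heq => by
        have harg0 : 0 < ε + (1 + ε) * t := by nlinarith [ht.1]
        have hargpi : ε + (1 + ε) * t < Real.pi := by nlinarith [ht.2]
        have hsin := Real.sin_pos_of_pos_of_lt_pi harg0 hargpi
        have hsc := Real.sin_sq_add_cos_sq (ε + (1 + ε) * t)
        have hyt := hy t ht.1
        have hzt : z t = Real.cos (ε + (1 + ε) * t) := by linarith
        rw [hzt] at hyt
        have : -y t ≤ Real.sin (ε + (1 + ε) * t) := by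
          have := (abs_le.1 (abs_le_of_sq_le_sq (by linarith : y t ^ 2 ≤ _) hsin.le)).1
          linarith
        nlinarith)
      (Set.right_mem_Icc.2 hT0)
    linarith
  have hlim : Filter.Tendsto (fun ε : ℝ => Real.cos (ε + (1 + ε) * T)) (nhdsWithin 0 (Set.Ioi 0))
      (nhds (Real.cos T)) := by
    have := (by fun_prop : Continuous fun ε : ℝ => Real.cos (ε + (1 + ε) * T)).tendsto 0
    simp only [zero_add, add_zero, one_mul] at this
    exact this.mono_left nhdsWithin_le_nhds
  exact le_of_tendsto hlim key

theorem continuous_entry (i j : Fin 3) : Continuous fun Θ : SO3 => Θ.1 i j :=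
  (continuous_apply_apply i j).comp continuous_subtype_val

theorem IsTrajectory.cos_le {v : ℝ → ℝ} {Θ : ℝ → SO3}
    (h : IsTrajectory OmegaZ OmegaX v 1 Θ) {t : ℝ} (ht0 : 0 ≤ t) (ht : t < Real.pi) :
    Real.cos t ≤ (Θ t).1 2 2 := by
  have hcont : ∀ i j, ContinuousOn (fun s => (Θ s).1 i j) (Set.Ici 0) := fun i j =>
    (continuous_entry i j).comp_continuousOn h.1
  -- Freezing `y` at negative times makes it continuous on all of `ℝ`, so `z` is differentiable
  -- although the control is only measurable.
  set y : ℝ → ℝ := fun s => (Θ (max s 0)).1 1 2 with hy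
  have hyc : Continuous y := (hcont 1 2).comp_continuous (by fun_prop) fun s => le_max_right s 0
  have hz : ∀ s, 0 ≤ s → (Θ s).1 2 2 = 1 + ∫ u in (0 : ℝ)..s, y u := by
    intro s hs
    rw [h.2 s hs 2 2]
    congr 1
    refine intervalIntegral.integral_congr fun u hu => ?_
    rw [Set.uIcc_of_le hs] at hu
    simp [hy, OmegaZ, OmegaX, Matrix.mul_apply, Fin.sum_univ_three, max_eq_left hu.1]
  refine cos_le_of_hasDerivWithinAt (z := fun s => (Θ s).1 2 2) (y := y) (hcont 2 2)
    (by simpa using hz 0 le_rfl) (fun s hs => ?_) (fun s hs => ?_) ht0 ht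
  · have hd := (intervalIntegral.integral_hasDerivAt_right (hyc.intervalIntegrable 0 s)
      (hyc.stronglyMeasurableAtFilter _ _) hyc.continuousAt).const_add (1 : ℝ)
    exact hd.hasDerivWithinAt.congr (fun u hu => hz u (le_trans hs hu)) (hz s hs)
  · have := SO3.col_sq (Θ s) 2
    simp only [hy, max_eq_left hs]
    nlinarith [sq_nonneg ((Θ s).1 0 2)]

theorem cos_le_of_mem_closure_reachableWithin {Θ : SO3} {T : ℝ} (hT : T < Real.pi)
    (h : Θ ∈ closure (reachableWithin OmegaZ OmegaX 1 T)) : Real.cos T ≤ Θ.1 2 2 := by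
  have hclosed : IsClosed {Θ : SO3 | Real.cos T ≤ Θ.1 2 2} :=
    isClosed_le continuous_const (continuous_entry 2 2)
  refine closure_minimal ?_ hclosed h
  intro Q hQ
  simp only [reachableWithin, Set.mem_iUnion] at hQ
  obtain ⟨t, ht, v, Φ, -, hΦ, rfl⟩ := hQ
  exact (Real.cos_le_cos_of_nonneg_of_le_pi ht.1 hT.le ht.2).trans
    (hΦ.cos_le ht.1 (ht.2.trans_lt hT))

/-! ### Approximation by impulses and drift -/

/-- The rotation `exp (s (Ω_z + a Ω_x))`. -/
noncomputable def flow (a s : ℝ) : SO3 :=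
  ⟨NormedSpace.exp (s • (OmegaZ + a • OmegaX)), exp_mem_SO3 <| by
    ext i j; fin_cases i <;> fin_cases j <;> simp [OmegaX, OmegaZ]⟩

theorem continuous_flow (a : ℝ) : Continuous (flow a) :=
  Continuous.subtype_mk (continuous_matrix_exp.comp (by fun_prop)) _

theorem flow_zero (a : ℝ) : flow a 0 = 1 := by
  apply Subtype.ext; simp [flow]

theorem integral_flow (a r s t : ℝ) (g : SO3) (i j : Fin 3) :
    ∫ u in s..t, ((OmegaZ + a • OmegaX) * (flow a (u - r) * g).1) i j =
      (flow a (t - r) * g).1 i j - (flow a (s - r) * g).1 i j := by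
  refine intervalIntegral.integral_eq_sub_of_hasDerivAt
    (f := fun u => (flow a (u - r) * g).1 i j) (fun u _ => ?_) ?_
  · exact (hasDerivAt_exp_mul_apply (OmegaZ + a • OmegaX) g.1 (u - r) i j).comp_sub_const u r
  · apply Continuous.intervalIntegrable
    have : Continuous fun u => (flow a (u - r) * g).1 :=
      continuous_subtype_val.comp
        (((continuous_flow a).comp (by fun_prop : Continuous fun u : ℝ => u - r)).mul
          continuous_const)
    exact ((continuous_const.matrix_mul this).matrix_elem i j)

theorem one_mem_reachableAt_zero : (1 : SO3) ∈ reachableAt OmegaZ OmegaX 1 0 := by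
  refine ⟨fun _ => 0, flow 0, ⟨measurable_const, fun _ => ⟨0, by simp⟩⟩,
    ⟨(continuous_flow 0).continuousOn, fun t _ i j => ?_⟩, flow_zero 0⟩
  have := integral_flow 0 0 0 t 1 i j
  simp only [sub_zero, mul_one, flow_zero] at this
  rw [this]
  ring

theorem IsTrajectory.intervalIntegrable {Xd X₁ : Matrix (Fin 3) (Fin 3) ℝ} {v : ℝ → ℝ}
    {Θ₀ : SO3} {Θ : ℝ → SO3} (hv : IsControl v) (h : IsTrajectory Xd X₁ v Θ₀ Θ) {t : ℝ}
    (ht : 0 ≤ t) (i j : Fin 3) :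
    IntervalIntegrable (fun s => ((Xd + v s • X₁) * (Θ s).1) i j) volume 0 t := by
  have hcont : ∀ A : Matrix (Fin 3) (Fin 3) ℝ,
      IntervalIntegrable (fun s => (A * (Θ s).1) i j) volume 0 t := by
    intro A
    refine ContinuousOn.intervalIntegrable ?_
    rw [Set.uIcc_of_le ht]
    have : Continuous fun Q : SO3 => (A * Q.1) i j :=
      (continuous_const.matrix_mul continuous_subtype_val).matrix_elem i j
    exact this.comp_continuousOn (h.1.mono Set.Icc_subset_Ici_self)
  have hprod : IntervalIntegrable (fun s => v s * (X₁ * (Θ s).1) i j) volume 0 t := by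
    obtain ⟨M, hM⟩ := hv.2 t
    rw [intervalIntegrable_iff_integrableOn_Ioc_of_le ht]
    refine Integrable.bdd_mul (c := M)
      ((intervalIntegrable_iff_integrableOn_Ioc_of_le ht).1 (hcont X₁))
      hv.1.aestronglyMeasurable ?_
    filter_upwards [ae_restrict_mem measurableSet_Ioc] with s hs
    exact hM s (Set.Ioc_subset_Icc_self hs)
  convert (hcont Xd).add hprod using 2 with s
  simp [Matrix.add_mul]

/-- Attainable points may be prolonged by a constant control. -/
theorem flow_mul_mem_reachableAt {Θ₀ g : SO3} {t : ℝ} (ht : 0 ≤ t)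
    (hg : g ∈ reachableAt OmegaZ OmegaX Θ₀ t) (a : ℝ) {s : ℝ} (hs : 0 ≤ s) :
    flow a s * g ∈ reachableAt OmegaZ OmegaX Θ₀ (t + s) := by
  obtain ⟨v, Θ, hv, hΘ, rfl⟩ := hg
  have hafter : ∀ u, t ≤ u → (if u ≤ t then Θ u else flow a (u - t) * Θ t) =
      flow a (u - t) * Θ t := by
    intro u hu
    split_ifs with h
    · obtain rfl := le_antisymm h hu
      simp [flow_zero]
    · rfl
  refine ⟨fun u => if u ≤ t then v u else a, fun u => if u ≤ t then Θ u else
    flow a (u - t) * Θ t, ⟨?_, ?_⟩, ⟨?_, ?_⟩, ?_⟩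
  · exact Measurable.ite measurableSet_Iic hv.1 measurable_const
  · intro T
    obtain ⟨M, hM⟩ := hv.2 T
    refine ⟨max M |a|, fun u hu => ?_⟩
    dsimp only
    split_ifs
    · exact (hM u hu).trans (le_max_left _ _)
    · exact le_max_right _ _
  · have hf : Continuous fun u => flow a (u - t) * Θ t :=
      ((continuous_flow a).comp (by fun_prop : Continuous fun u : ℝ => u - t)).mul
        continuous_const
    have hset : Set.Ici (0 : ℝ) = Set.Icc 0 t ∪ Set.Ici t := (Set.Icc_union_Ici_eq_Ici ht).symm
    rw [hset]
    refine ContinuousOn.union_of_isClosed ?_ ?_ isClosed_Icc isClosed_Ici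
    · exact (hΘ.1.mono Set.Icc_subset_Ici_self).congr fun u hu => if_pos hu.2
    · exact hf.continuousOn.congr fun u hu => hafter u hu
  · have hbefore : ∀ w, w ≤ t → 0 ≤ w → ∀ i j, ∫ u in (0 : ℝ)..w,
        ((OmegaZ + (if u ≤ t then v u else a) • OmegaX) *
          (if u ≤ t then Θ u else flow a (u - t) * Θ t).1) i j =
        ∫ u in (0 : ℝ)..w, ((OmegaZ + v u • OmegaX) * (Θ u).1) i j := by
      intro w hw hw0 i j
      refine intervalIntegral.integral_congr fun u hu => ?_
      rw [Set.uIcc_of_le hw0] at hu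
      simp only [if_pos (hu.2.trans hw)]
    intro w hw i j
    beta_reduce
    rcases le_total w t with hwt | hwt
    · rw [hbefore w hwt hw, if_pos hwt]
      exact hΘ.2 w hw i j
    · have heq : Set.EqOn (fun u => ((OmegaZ + a • OmegaX) * (flow a (u - t) * Θ t).1) i j)
          (fun u => ((OmegaZ + (if u ≤ t then v u else a) • OmegaX) *
            (if u ≤ t then Θ u else flow a (u - t) * Θ t).1) i j) (Set.uIoc t w) := by
        intro u hu
        rw [Set.uIoc_of_le hwt] at hu
        simp only [if_neg (not_le.2 hu.1)]
      have hint₁ : IntervalIntegrable (fun u =>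
          ((OmegaZ + (if u ≤ t then v u else a) • OmegaX) *
            (if u ≤ t then Θ u else flow a (u - t) * Θ t).1) i j) volume 0 t := by
        refine (hΘ.intervalIntegrable hv ht i j).congr fun u hu => ?_
        rw [Set.uIoc_of_le ht] at hu
        simp only [if_pos hu.2]
      have hcont : Continuous fun u => ((OmegaZ + a • OmegaX) * (flow a (u - t) * Θ t).1) i j :=
        (continuous_const.matrix_mul (continuous_subtype_val.comp
          (((continuous_flow a).comp (by fun_prop : Continuous fun u : ℝ => u - t)).mul
            continuous_const))).matrix_elem i j
      have hint₂ := (hcont.intervalIntegrable (μ := volume) t w).congr heq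
      have htail := (intervalIntegral.integral_congr_ae
        (Filter.Eventually.of_forall fun u hu => heq hu) : ∫ u in t..w, _ = ∫ u in t..w, _)
      rw [← intervalIntegral.integral_add_adjacent_intervals hint₁ hint₂, hbefore t le_rfl ht,
        ← htail, integral_flow, hafter w hwt, sub_self, flow_zero, one_mul, ← add_assoc,
        ← hΘ.2 t ht i j]
      ring
  · have := hafter (t + s) (by linarith)
    simpa using this

/-- Since `h (Ω_z + (t/h) Ω_x) = h Ω_z + t Ω_x`, the drift disappears as `h → 0`. -/
theorem tendsto_flow_div (t : ℝ) :
    Filter.Tendsto (fun h : ℝ => (flow (t / h) h).1) (nhdsWithin 0 (Set.Ioi 0))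
      (nhds (NormedSpace.exp (t • OmegaX))) := by
  have hlim : Filter.Tendsto (fun h : ℝ => NormedSpace.exp (h • OmegaZ + t • OmegaX))
      (nhdsWithin 0 (Set.Ioi 0)) (nhds (NormedSpace.exp (t • OmegaX))) := by
    have hc : Continuous fun h : ℝ => NormedSpace.exp (h • OmegaZ + t • OmegaX) :=
      continuous_matrix_exp.comp (by fun_prop)
    have := hc.tendsto 0
    simp only [zero_smul, zero_add] at this
    exact this.mono_left nhdsWithin_le_nhds
  refine hlim.congr' ?_
  filter_upwards [self_mem_nhdsWithin] with h hh
  have hh : h ≠ 0 := (Set.mem_Ioi.1 hh).ne'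
  simp only [flow, smul_add, smul_smul, mul_div_cancel₀ t hh]

/-- A rotation with Euler angle `β` is approached by trajectories within any time exceeding `β`. -/
theorem HasDecomposition.mem_approachTimes {Θ : SO3} {β T : ℝ} (h : HasDecomposition Θ β)
    (hβ : 0 ≤ β) (hT : β < T) : T ∈ approachTimes OmegaZ OmegaX Θ := by
  obtain ⟨Q₁, ⟨t₁, h₁⟩, Q₂, ⟨t₂, h₂⟩, hΘ⟩ := h
  refine ⟨hβ.trans hT.le, ?_⟩
  -- The rightmost factor acts first; total duration is `β + 2r`, hence the later requirement `r <
  -- (T - β) / 2`.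
  have hlim : Filter.Tendsto (fun r : ℝ => flow (t₁ / r) r * (flow 0 β * flow (t₂ / r) r))
      (nhdsWithin 0 (Set.Ioi 0)) (nhds Θ) := by
    rw [tendsto_subtype_rng, hΘ, h₁, h₂, Matrix.mul_assoc]
    have hmid : (flow 0 β).1 = NormedSpace.exp (β • OmegaZ) := by simp [flow]
    rw [← hmid]
    exact (tendsto_flow_div t₁).mul (tendsto_const_nhds.mul (tendsto_flow_div t₂))
  refine mem_closure_of_tendsto hlim ?_
  have hsmall : ∀ᶠ r : ℝ in nhdsWithin 0 (Set.Ioi 0), r < (T - β) / 2 :=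
    (eventually_lt_nhds (by linarith)).filter_mono nhdsWithin_le_nhds
  filter_upwards [hsmall, self_mem_nhdsWithin] with r hr hr0
  have hr0 : 0 < r := hr0
  have hreach := flow_mul_mem_reachableAt (by linarith)
    (flow_mul_mem_reachableAt (by linarith)
      (flow_mul_mem_reachableAt le_rfl one_mem_reachableAt_zero (t₂ / r) hr0.le) 0 hβ)
    (t₁ / r) hr0.le
  rw [mul_one] at hreach
  exact Set.mem_biUnion (⟨by linarith, by linarith⟩ : 0 + r + β + r ∈ Set.Icc 0 T) hreach

theorem HasDecomposition.infimizingTime_eq {Θ : SO3} {β : ℝ} (h : HasDecomposition Θ β)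
    (hβ : β ∈ Set.Icc 0 Real.pi) : (approachTimes OmegaZ OmegaX Θ).Nonempty ∧
      infimizingTime OmegaZ OmegaX Θ = β := by
  have hne : (approachTimes OmegaZ OmegaX Θ).Nonempty :=
    ⟨β + 1, h.mem_approachTimes hβ.1 (by linarith)⟩
  refine ⟨hne, csInf_eq_of_forall_ge_of_forall_gt_exists_lt hne ?_ ?_⟩
  · rintro T ⟨hT0, hT⟩
    by_contra! hlt
    have hcos := cos_le_of_mem_closure_reachableWithin (hlt.trans_le hβ.2) hT
    rw [h.apply_two_two] at hcos
    exact absurd (Real.cos_lt_cos_of_nonneg_of_le_pi hT0 hβ.2 hlt) hcos.not_gt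
  · intro w hw
    exact ⟨(β + w) / 2, h.mem_approachTimes hβ.1 (by linarith), by linarith⟩

end TimeOptimal

theorem corollary3 (ΘF : TimeOptimal.SO3) :
    (∃! β : ℝ, β ∈ Set.Icc 0 Real.pi ∧ TimeOptimal.HasDecomposition ΘF β) ∧
      ∀ β ∈ Set.Icc 0 Real.pi, TimeOptimal.HasDecomposition ΘF β →
        (TimeOptimal.approachTimes TimeOptimal.OmegaZ TimeOptimal.OmegaX ΘF).Nonempty ∧
          TimeOptimal.infimizingTime TimeOptimal.OmegaZ TimeOptimal.OmegaX ΘF = β :=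
  ⟨TimeOptimal.existsUnique_hasDecomposition ΘF, fun _ hβ h => h.infimizingTime_eq hβ⟩
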